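/- Let $U$ be a compact connected Lie group, $\theta$ a smooth involutive automorphism of $U$ (that is, $\theta^2=\mathrm{id}$), and $K$ a closed subgroup with $(U^\theta)_0\subseteq K\subseteq U^\theta$, where $U^\theta$ is the group of fixed points of $\theta$ and $(U^\theta)_0$ its identity component, so that $U/K$ is a compact symmetric space. Let $m_K$ be the normalized Haar measure of $K$. For $a\in U$ let $\mu_a$ be the probability measure on $U$ with $$\int_U f\,\mathrm{d}\mu_a=\int_K\int_K f(k_1ak_2)\,\mathrm{d}m_K(k_1)\,\mathrm{d}m_K(k_2)\qquad(f\in C(U)),$$ and for an integer $p\ge 2$ let $\mu_a^{(p)}$ be the convolution of $p$ copies of $\mu_a$. Let $\widehat U$ be the set of equivalence classes of (continuous, finite-dimensional) irreducible unitary representations of $U$, and fix a representative $(\pi,E_\pi)$ of each class. For a finite measure $\mu$ on $U$ put $$\widehat\mu(\pi)X=\int_U\pi(g^{-1})X\,\mathrm{d}\mu(g)\quad(X\in E_\pi),\qquad \|\widehat\mu\|_2^2=\sum_{[\pi]\in\widehat U}(\dim E_\pi)\,\|\widehat\mu(\pi)\|_{\mathrm{HS}}^2\in[0,\infty],$$ where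 $\|\cdot\|_{\mathrm{HS}}$ is the Hilbert--Schmidt norm. Call $\pi$ spherical if the space $E_\pi^K$ of $K$-fixed vectors in $E_\pi$ is one-dimensional, and in that case let $X_\pi\in E_\pi^K$ be any vector with $\|X_\pi\|=1$. Then, for all $a\in U$ and all integers $p\ge2$, $$\big\|\widehat{\mu_a^{(p)}}\big\|_2^2=\sum_{\substack{[\pi]\in\widehat U\\ \pi\ \text{spherical}}}(\dim E_\pi)\,\big|(\pi(a)X_\pi,X_\pi)\big|^{2p}$$ as an equality in $[0,\infty]$ (both sides may be infinite). -/

import Mathlib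

open MeasureTheory Module
open scoped Manifold ContDiff ENNReal

/-- `(U, K)` is a symmetric pair with respect to `θ`: `θ` is a smooth involutive automorphism of
the Lie group `U`, and `K` is a closed subgroup lying between the identity component of the
fixed-point group of `θ` and the fixed-point group itself.  If `U` is moreover compact and
connected, `U / K` is a compact symmetric space. -/
structure IsSymmetricPair {V : Type*} [NormedAddCommGroup V] [NormedSpace ℝ V]
    {U : Type*} [Group U] [TopologicalSpace U] [ChartedSpace V U]
    (θ : U →* U) (K : Subgroup U) : Prop where
  contMDiff : ContMDiff 𝓘(ℝ, V) 𝓘(ℝ, V) ∞ θ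
  involutive : Function.Involutive θ
  isClosed : IsClosed (K : Set U)
  identityComponent_subset : connectedComponentIn {g : U | θ g = g} 1 ⊆ (K : Set U)
  subset_fixedPoints : (K : Set U) ⊆ {g : U | θ g = g}

/-- A continuous irreducible unitary representation of `U` on a finite-dimensional complex inner
product space. -/
structure UnitaryIrrep (U : Type*) [Group U] [TopologicalSpace U] where
  /-- The space of the representation. -/
  E : Type
  [normedAddCommGroup : NormedAddCommGroup E]
  [innerProductSpace : InnerProductSpace ℂ E]
  [finiteDimensional : FiniteDimensional ℂ E]
  /-- The action of the group. -/
  ρ : Representation ℂ U E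
  continuous_apply : ∀ v : E, Continuous fun g : U => ρ g v
  inner_map_map : ∀ (g : U) (v w : E), inner ℂ (ρ g v) (ρ g w) = inner ℂ v w
  irreducible : ρ.IsIrreducible

namespace UnitaryIrrep

attribute [instance] normedAddCommGroup innerProductSpace finiteDimensional

section

variable {U : Type*} [Group U] [TopologicalSpace U]

/-- Unitary equivalence of irreducible unitary representations. -/
instance setoid (U : Type*) [Group U] [TopologicalSpace U] : Setoid (UnitaryIrrep U) where
  r π σ := ∃ T : π.E ≃ₗᵢ[ℂ] σ.E, ∀ (g : U) (v : π.E), T (π.ρ g v) = σ.ρ g (T v)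
  iseqv :=
    { refl := fun π => ⟨LinearIsometryEquiv.refl ℂ π.E, fun _ _ => rfl⟩
      symm := by
        rintro π σ ⟨T, hT⟩
        refine ⟨T.symm, fun g v => ?_⟩
        apply T.injective
        simp [hT]
      trans := by
        rintro π σ τ ⟨S, hS⟩ ⟨T, hT⟩
        exact ⟨S.trans T, fun g v => by simp [hS, hT]⟩ }

/-- The space `E_π^K` of `K`-fixed vectors. -/
noncomputable def fixedVectors (π : UnitaryIrrep U) (K : Subgroup U) : Submodule ℂ π.E :=
  Representation.invariants (π.ρ.comp K.subtype)

/-- `π` is spherical (of class one) if its space of `K`-fixed vectors is one-dimensional. -/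
def IsSpherical (π : UnitaryIrrep U) (K : Subgroup U) : Prop :=
  finrank ℂ (π.fixedVectors K) = 1

/-- The squared Hilbert--Schmidt norm of an endomorphism of `E_π`. -/
noncomputable def hsNormSq (π : UnitaryIrrep U) (T : π.E →ₗ[ℂ] π.E) : ℝ :=
  ∑ i, ‖T (stdOrthonormalBasis ℂ π.E i)‖ ^ 2

variable [IsTopologicalGroup U] [CompactSpace U] [MeasurableSpace U] [BorelSpace U]

theorem integrable_apply_inv (π : UnitaryIrrep U) (μ : Measure U) [IsFiniteMeasure μ]
    (v : π.E) : Integrable (fun g : U => π.ρ g⁻¹ v) μ := by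
  have hc : Continuous fun g : U => π.ρ g⁻¹ v := (π.continuous_apply v).comp continuous_inv
  have : ProperSpace π.E := FiniteDimensional.proper ℂ π.E
  exact hc.integrable_of_hasCompactSupport (HasCompactSupport.of_compactSpace _)

/-- The Fourier transform `X ↦ ∫ π(g⁻¹) X dμ(g)` of a finite measure at `π`. -/
noncomputable def fourier (π : UnitaryIrrep U) (μ : Measure U) [IsFiniteMeasure μ] :
    π.E →ₗ[ℂ] π.E where
  toFun v := ∫ g, π.ρ g⁻¹ v ∂μ
  map_add' v w := by
    simp only [map_add]
    exact integral_add (π.integrable_apply_inv μ v) (π.integrable_apply_inv μ w)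
  map_smul' c v := by
    simp only [map_smul, RingHom.id_apply]
    exact integral_smul c _

end

end UnitaryIrrep

/-- The unitary dual: equivalence classes of irreducible unitary representations. -/
abbrev UnitaryDual (U : Type*) [Group U] [TopologicalSpace U] : Type _ :=
  Quotient (UnitaryIrrep.setoid U)

section Measures

variable {U : Type*} [Group U] [MeasurableSpace U]

/-- The orbital measure on `K a K`: the image of `m_K × m_K` under `(k₁, k₂) ↦ k₁ a k₂`. -/
noncomputable def orbitalMeasure {K : Subgroup U} (mK : Measure K) (a : U) : Measure U :=
  Measure.map (fun k : K × K => (k.1 : U) * a * (k.2 : U)) (mK.prod mK)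

instance {K : Subgroup U} (mK : Measure K) [IsFiniteMeasure mK] (a : U) :
    IsFiniteMeasure (orbitalMeasure mK a) := by
  unfold orbitalMeasure
  infer_instance

/-- The `p`-fold convolution power of a measure. -/
noncomputable def convPow (μ : Measure U) : ℕ → Measure U
  | 0 => Measure.dirac 1
  | p + 1 => Measure.mconv (convPow μ p) μ

instance (μ : Measure U) [IsFiniteMeasure μ] (p : ℕ) : IsFiniteMeasure (convPow μ p) := by
  induction p with
  | zero => unfold convPow; infer_instance
  | succ p ih => unfold convPow Measure.mconv; infer_instance

end Measures

/-- The squared Plancherel norm `∑_{[π]} (dim E_π) ‖μ̂(π)‖²_HS ∈ [0, ∞]` of the Fourier transform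
of `μ`, computed with a representative `r c` of each class `c` of the unitary dual. -/
noncomputable def plancherelNormSq {U : Type*} [Group U] [TopologicalSpace U]
    [IsTopologicalGroup U] [CompactSpace U] [MeasurableSpace U] [BorelSpace U]
    (r : UnitaryDual U → UnitaryIrrep U) (μ : Measure U) [IsFiniteMeasure μ] : ℝ≥0∞ :=
  ∑' c : UnitaryDual U,
    (finrank ℂ (r c).E : ℝ≥0∞) * ENNReal.ofReal ((r c).hsNormSq ((r c).fourier μ))

/-!
Let `P` be the orthogonal projection of `E_π` onto the `K`-fixed vectors.  Averaging over `K` gives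
`μ̂_a(π) = P π(a⁻¹) P`, and the Fourier transform takes convolution powers to powers.  If `(U, K)`
is a Gelfand pair, `P` has rank at most one.  Hence `μ̂_a(π) = 0` unless `π` is spherical, and then
`μ̂_a(π)^p = c^p P` with `c = (π(a⁻¹) X, X)` and `‖P‖_HS = 1`.

A symmetric pair is a Gelfand pair because the compressions `P π(g) P` commute: the coefficients
`φ(g) = (π(g) v, w)` of `K`-fixed vectors satisfy `φ(θ(g)⁻¹) = φ(g)`, so the compressions are
invariant under the antiautomorphism `g ↦ θ(g)⁻¹`, which maps `g k h` to `θ(h)⁻¹ k⁻¹ θ(g)⁻¹`.  For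
`g` near `1` the symmetry of `φ` follows from a factorization `g = k s` with `k ∈ (U^θ)₀` and
`θ(s) = s⁻¹`, in which `s` is the square root of `θ(g)⁻¹ g`.  It then holds everywhere, since the
values of a finite-dimensional representation of a connected group near `1` span all its values.
-/

open Filter Topology Set

section LocalInverse

variable {𝕜 : Type*} [RCLike 𝕜]
  {V : Type*} [NormedAddCommGroup V] [NormedSpace 𝕜 V]
  {W : Type*} [NormedAddCommGroup W] [NormedSpace 𝕜 W]
  {M : Type*} [TopologicalSpace M] [ChartedSpace V M]
  {N : Type*} [TopologicalSpace N] [ChartedSpace W N]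

theorem contDiffAt_chartAt_comp_symm {n : ℕ∞ω} {f : M → N} {x : M}
    (hf : ContMDiffAt 𝓘(𝕜, V) 𝓘(𝕜, W) n f x) :
    ContDiffAt 𝕜 n (chartAt W (f x) ∘ f ∘ (chartAt V x).symm) (chartAt V x x) := by
  have := (contMDiffAt_iff.1 hf).2
  simpa only [mfld_simps, contDiffWithinAt_univ] using this

theorem hasFDerivAt_chartAt_comp_symm {f : M → N} {x : M} {f' : V →L[𝕜] W}
    (hf : HasMFDerivAt 𝓘(𝕜, V) 𝓘(𝕜, W) f x f') :
    HasFDerivAt (chartAt W (f x) ∘ f ∘ (chartAt V x).symm) f' (chartAt V x x) := by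
  have := hf.2
  simp only [writtenInExtChartAt, mfld_simps] at this
  exact hasFDerivWithinAt_univ.1 this

theorem exists_openPartialHomeomorph_eqOn_of_hasMFDerivAt [CompleteSpace V] {n : ℕ∞ω}
    {f : M → N} {x : M} (hf : ContMDiffAt 𝓘(𝕜, V) 𝓘(𝕜, W) n f x) (hn : n ≠ 0) {f' : V ≃L[𝕜] W}
    (hf' : HasMFDerivAt 𝓘(𝕜, V) 𝓘(𝕜, W) f x (f' : V →L[𝕜] W)) :
    ∃ Φ : OpenPartialHomeomorph M N, x ∈ Φ.source ∧ EqOn Φ f Φ.source := by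
  have hF : HasStrictFDerivAt (chartAt W (f x) ∘ f ∘ (chartAt V x).symm) (f' : V →L[𝕜] W)
      (chartAt V x x) :=
    (contDiffAt_chartAt_comp_symm hf).hasStrictFDerivAt' (hasFDerivAt_chartAt_comp_symm hf') hn
  refine ⟨((chartAt V x).trans ((hF.toOpenPartialHomeomorph _).trans (chartAt W (f x)).symm)).restr
    (f ⁻¹' (chartAt W (f x)).source), ?_, ?_⟩
  · have hx : x ∈ interior (f ⁻¹' (chartAt W (f x)).source) :=
      mem_interior_iff_mem_nhds.2 (hf.continuousAt (chart_source_mem_nhds W (f x)))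
    simp [hx, hF.mem_toOpenPartialHomeomorph_source]
  · intro y hy
    simp only [OpenPartialHomeomorph.restr_source, OpenPartialHomeomorph.trans_source,
      mem_inter_iff] at hy
    have hfy := interior_subset hy.2
    simp [(chartAt V x).left_inv hy.1.1, (chartAt W (f x)).left_inv hfy]

end LocalInverse

section LocalInvolution

theorem exists_openPartialHomeomorph_conj_fderiv {𝕜 V : Type*} [NontriviallyNormedField 𝕜]
    [NeZero (2 : 𝕜)] [NormedAddCommGroup V] [NormedSpace 𝕜 V] [CompleteSpace V]
    {f : V → V} {L : V →L[𝕜] V} {x : V} (hf : HasStrictFDerivAt f L x) (hx : f x = x)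
    (hff : ∀ᶠ y in 𝓝 x, f (f y) = y) :
    ∃ Φ : OpenPartialHomeomorph V V, x ∈ Φ.source ∧ Φ x = 0 ∧ ∀ᶠ y in 𝓝 x, Φ (f y) = L (Φ y) := by
  have hLL (v : V) : L (L v) = v := by
    have hcomp : HasFDerivAt (f ∘ f) (L ∘L L) x :=
      HasFDerivAt.comp x (hx.symm ▸ hf.hasFDerivAt) hf.hasFDerivAt
    exact DFunLike.congr_fun (hcomp.unique ((hasFDerivAt_id x).congr_of_eventuallyEq hff)) v
  -- averaging over the two-element group generated by `f` (Bochner's linearization)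
  let Ψ : V → V := fun y => (2 : 𝕜)⁻¹ • ((y - x) + L (f y - x))
  have hΨ : HasStrictFDerivAt Ψ (ContinuousLinearEquiv.refl 𝕜 V : V →L[𝕜] V) x := by
    refine ((((hasStrictFDerivAt_id (𝕜 := 𝕜) x).sub_const x).add
      (L.hasStrictFDerivAt.comp x (hf.sub_const x))).const_smul (2 : 𝕜)⁻¹).congr_fderiv
        (ContinuousLinearMap.ext fun v => ?_)
    change (2 : 𝕜)⁻¹ • (v + L (L v)) = v
    rw [hLL, ← two_smul 𝕜 v, inv_smul_smul₀ (two_ne_zero (α := 𝕜))]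
  refine ⟨hΨ.toOpenPartialHomeomorph Ψ, hΨ.mem_toOpenPartialHomeomorph_source, by simp [Ψ, hx], ?_⟩
  filter_upwards [hff] with y hy
  simp [Ψ, hy, hLL, add_comm]

variable {V : Type*} [NormedAddCommGroup V] {M : Type*} [TopologicalSpace M]

theorem exists_openPartialHomeomorph_conj_linear {𝕜 : Type*} [RCLike 𝕜] [NormedSpace 𝕜 V]
    [CompleteSpace V] [ChartedSpace V M] {n : ℕ∞ω} {f : M → M} {x : M}
    (hf : ContMDiffAt 𝓘(𝕜, V) 𝓘(𝕜, V) n f x) (hn : n ≠ 0) (hx : f x = x)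
    (hff : ∀ᶠ y in 𝓝 x, f (f y) = y) :
    ∃ (Φ : OpenPartialHomeomorph M V) (L : V →L[𝕜] V),
      x ∈ Φ.source ∧ Φ x = 0 ∧ ∀ᶠ y in 𝓝 x, Φ (f y) = L (Φ y) := by
  set e := chartAt V x
  have hxe : x ∈ e.source := mem_chart_source V x
  have hfe : ∀ᶠ y in 𝓝 x, f y ∈ e.source :=
    hf.continuousAt (by rw [hx]; exact e.open_source.mem_nhds hxe)
  have hF : ContDiffAt 𝕜 n (e ∘ f ∘ e.symm) (e x) := by
    simpa only [hx] using contDiffAt_chartAt_comp_symm hf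
  have hFF : ∀ᶠ y in 𝓝 (e x), (e ∘ f ∘ e.symm) ((e ∘ f ∘ e.symm) y) = y := by
    rw [← e.map_nhds_eq hxe, eventually_map]
    filter_upwards [e.open_source.mem_nhds hxe, hfe, hff] with y hye hfye hffy
    simp [e.left_inv hye, e.left_inv hfye, hffy]
  obtain ⟨Φ, hxΦ, hΦx, hΦ⟩ := exists_openPartialHomeomorph_conj_fderiv
    (hF.hasStrictFDerivAt hn) (by simp [e.left_inv hxe, hx]) hFF
  refine ⟨e.trans Φ, fderiv 𝕜 (e ∘ f ∘ e.symm) (e x), by simp [hxe, hxΦ], by simpa using hΦx, ?_⟩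
  filter_upwards [e.open_source.mem_nhds hxe, (e.continuousAt hxe).eventually hΦ] with y hye hy
  simpa [e.left_inv hye] using hy

theorem eventually_mem_connectedComponentIn_fixedPoints [NormedSpace ℝ V]
    {Φ : OpenPartialHomeomorph M V} {L : V →ₗ[ℝ] V} {f : M → M} {x : M}
    (hf : ContinuousAt f x) (hx : f x = x) (hxΦ : x ∈ Φ.source) (hΦx : Φ x = 0)
    (hΦ : ∀ᶠ y in 𝓝 x, Φ (f y) = L (Φ y)) :
    ∀ᶠ y in 𝓝 x, f y = y → y ∈ connectedComponentIn {y | f y = y} x := by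
  have hfΦ : ∀ᶠ y in 𝓝 x, f y ∈ Φ.source :=
    hf (by rw [hx]; exact Φ.open_source.mem_nhds hxΦ)
  have hchart : ∀ᶠ z in 𝓝 (0 : V), z ∈ Φ.target ∧ f (Φ.symm z) ∈ Φ.source ∧
      Φ (f (Φ.symm z)) = L (Φ (Φ.symm z)) := by
    rw [← hΦx, ← Φ.map_nhds_eq hxΦ, eventually_map]
    filter_upwards [Φ.open_source.mem_nhds hxΦ, hfΦ, hΦ] with y hy hfy hΦy
    rw [Φ.left_inv hy]
    exact ⟨Φ.map_source hy, hfy, hΦy⟩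
  obtain ⟨ε, hε, hball⟩ := Metric.eventually_nhds_iff_ball.1 hchart
  let C : Set V := Metric.ball 0 ε ∩ LinearMap.eqLocus L LinearMap.id
  have hC : IsPreconnected C :=
    ((convex_ball 0 ε).inter (Submodule.convex _)).isPreconnected
  have hcont : ContinuousOn Φ.symm C := Φ.continuousOn_symm.mono fun z hz => (hball z hz.1).1
  have hfix : Φ.symm '' C ⊆ {y | f y = y} := by
    rintro _ ⟨z, ⟨hz, hLz⟩, rfl⟩
    obtain ⟨hzt, hfz, hΦz⟩ := hball z hz
    refine Φ.injOn hfz (Φ.map_target hzt) ?_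
    rw [hΦz, Φ.right_inv hzt]
    exact hLz
  have hsub := (hC.image _ hcont).subset_connectedComponentIn
    ⟨0, ⟨Metric.mem_ball_self hε, by simp⟩, by rw [← hΦx, Φ.left_inv hxΦ]⟩ hfix
  filter_upwards [Φ.open_source.mem_nhds hxΦ, hΦ,
    (Φ.continuousAt hxΦ) (by rw [hΦx]; exact Metric.ball_mem_nhds _ hε)] with y hy hΦy hyε hfy
  refine hsub ⟨Φ y, ⟨hyε, ?_⟩, Φ.left_inv hy⟩
  change L (Φ y) = Φ y
  rw [← hΦy, hfy]

end LocalInvolution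

section Squaring

variable {𝕜 : Type*} [NontriviallyNormedField 𝕜] {V : Type*} [NormedAddCommGroup V]
  [NormedSpace 𝕜 V] {U : Type*} [Monoid U] [TopologicalSpace U] [ChartedSpace V U] {n : ℕ∞ω}

theorem hasMFDerivAt_mul_self_one [ContMDiffMul 𝓘(𝕜, V) n U] (hn : n ≠ 0) :
    HasMFDerivAt 𝓘(𝕜, V) 𝓘(𝕜, V) (fun g : U => g * g) 1
      ((2 : 𝕜) • ContinuousLinearMap.id 𝕜 V) := by
  have hmul : MDiffAt (fun p : U × U => p.1 * p.2) ((1 : U), (1 : U)) :=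
    (contMDiff_mul 𝓘(𝕜, V) n).mdifferentiable hn _
  have hdiag : HasMFDerivAt 𝓘(𝕜, V) (𝓘(𝕜, V).prod 𝓘(𝕜, V)) (fun g : U => (g, g)) 1
      ((ContinuousLinearMap.id 𝕜 V).prod (ContinuousLinearMap.id 𝕜 V)) :=
    (hasMFDerivAt_id (I := 𝓘(𝕜, V)) (1 : U)).prodMk (hasMFDerivAt_id (I := 𝓘(𝕜, V)) (1 : U))
  have hcomp := HasMFDerivAt.comp (f := fun g : U => (g, g)) (1 : U) hmul.hasMFDerivAt hdiag
  have hid := hasMFDerivAt_id (I := 𝓘(𝕜, V)) (1 : U)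
  have hleft : HasMFDerivAt 𝓘(𝕜, V) 𝓘(𝕜, V) (fun g : U => g * 1) 1 (ContinuousLinearMap.id 𝕜 V) :=
    hid.congr_of_eventuallyEq (.of_forall mul_one)
  have hright : HasMFDerivAt 𝓘(𝕜, V) 𝓘(𝕜, V) (fun g : U => 1 * g) 1
      (ContinuousLinearMap.id 𝕜 V) :=
    hid.congr_of_eventuallyEq (.of_forall one_mul)
  refine hcomp.congr_mfderiv (ContinuousLinearMap.ext fun v => ?_)
  exact ((mfderiv_prod_eq_add_apply hmul).trans (congrArg₂ (· + ·)
    (DFunLike.congr_fun hleft.mfderiv v) (DFunLike.congr_fun hright.mfderiv v))).trans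
      (two_smul 𝕜 (v : V)).symm

end Squaring

section Cartan

theorem exists_openPartialHomeomorph_eqOn_mul_self {𝕜 V U : Type*} [RCLike 𝕜]
    [NormedAddCommGroup V] [NormedSpace 𝕜 V] [CompleteSpace V] [Monoid U] [TopologicalSpace U]
    [ChartedSpace V U] {n : ℕ∞ω} [ContMDiffMul 𝓘(𝕜, V) n U] (hn : n ≠ 0) :
    ∃ Φ : OpenPartialHomeomorph U U, 1 ∈ Φ.source ∧ EqOn Φ (fun g => g * g) Φ.source := by
  have hsmooth : ContMDiffAt 𝓘(𝕜, V) 𝓘(𝕜, V) n (fun g : U => g * g) 1 :=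
    contMDiffAt_id.mul contMDiffAt_id
  let two : V ≃L[𝕜] V := ContinuousLinearEquiv.smulLeft (Units.mk0 (2 : 𝕜) two_ne_zero)
  have htwo : (two : V →L[𝕜] V) = (2 : 𝕜) • ContinuousLinearMap.id 𝕜 V := rfl
  exact exists_openPartialHomeomorph_eqOn_of_hasMFDerivAt hsmooth hn (f' := two)
    (htwo ▸ hasMFDerivAt_mul_self_one hn)

theorem exists_tendsto_mul_self_eq_inv_mul {U : Type*} [Group U] [TopologicalSpace U]
    [IsTopologicalGroup U] {sq : OpenPartialHomeomorph U U} (h1 : 1 ∈ sq.source)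
    (hsq : EqOn sq (fun g => g * g) sq.source) {θ : U →* U} (hθ : ContinuousAt θ 1)
    (hθθ : Function.Involutive θ) :
    ∃ s : U → U, Tendsto s (𝓝 1) (𝓝 1) ∧
      ∀ᶠ g in 𝓝 1, s g * s g = (θ g)⁻¹ * g ∧ θ (s g) = (s g)⁻¹ := by
  have hsq1 : sq 1 = 1 := (hsq h1).trans (one_mul 1)
  have hsymm1 : sq.symm 1 = 1 := by rw [← hsq1, sq.left_inv h1, hsq1]
  have h1t : (1 : U) ∈ sq.target := hsq1 ▸ sq.map_source h1
  have hquot : Tendsto (fun g => (θ g)⁻¹ * g) (𝓝 1) (𝓝 1) := by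
    have : ContinuousAt (fun g : U => (θ g)⁻¹ * g) 1 := by fun_prop
    simpa [ContinuousAt] using this
  have hsymm : Tendsto sq.symm (𝓝 1) (𝓝 1) := by
    simpa [ContinuousAt, hsymm1] using sq.continuousAt_symm h1t
  let s : U → U := fun g => sq.symm ((θ g)⁻¹ * g)
  have hs : Tendsto s (𝓝 1) (𝓝 1) := hsymm.comp hquot
  have hsource : sq.source ∈ 𝓝 1 := sq.open_source.mem_nhds h1
  have hθs_mem : ∀ᶠ g in 𝓝 1, θ (s g) ∈ sq.source :=
    (Tendsto.comp (by simpa [ContinuousAt] using hθ) hs).eventually_mem hsource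
  have hs_inv_mem : ∀ᶠ g in 𝓝 1, (s g)⁻¹ ∈ sq.source :=
    (by simpa using hs.inv : Tendsto (fun g => (s g)⁻¹) (𝓝 1) (𝓝 1)).eventually_mem hsource
  refine ⟨s, hs, ?_⟩
  filter_upwards [hquot.eventually_mem (sq.open_target.mem_nhds h1t), hθs_mem, hs_inv_mem]
    with g hg hθs hsinv
  have hroot : s g * s g = (θ g)⁻¹ * g :=
    (hsq (sq.map_target hg)).symm.trans (sq.right_inv hg)
  refine ⟨hroot, sq.injOn hθs hsinv ?_⟩
  rw [hsq hθs, hsq hsinv]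
  calc θ (s g) * θ (s g) = θ ((θ g)⁻¹ * g) := by rw [← map_mul, hroot]
    _ = ((θ g)⁻¹ * g)⁻¹ := by simp [hθθ g]
    _ = (s g)⁻¹ * (s g)⁻¹ := by rw [← hroot, mul_inv_rev]

theorem eventually_exists_mul_eq_of_involutive {V : Type*} [NormedAddCommGroup V] [NormedSpace ℝ V]
    [CompleteSpace V] {U : Type*} [Group U] [TopologicalSpace U] [ChartedSpace V U] {n : ℕ∞ω}
    [LieGroup 𝓘(ℝ, V) n U] (hn : n ≠ 0) {θ : U →* U}
    (hθ : ContMDiffAt 𝓘(ℝ, V) 𝓘(ℝ, V) n θ 1) (hθθ : Function.Involutive θ) :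
    ∀ᶠ g in 𝓝 (1 : U), ∃ k ∈ connectedComponentIn {x | θ x = x} 1, ∃ s, θ s = s⁻¹ ∧ k * s = g := by
  have : IsTopologicalGroup U := topologicalGroup_of_lieGroup 𝓘(ℝ, V) n
  obtain ⟨Φ, L, h1Φ, hΦ1, hΦ⟩ := exists_openPartialHomeomorph_conj_linear hθ hn
    (map_one θ) (.of_forall hθθ)
  have hfixed := eventually_mem_connectedComponentIn_fixedPoints (L := L.toLinearMap)
    hθ.continuousAt (map_one θ) h1Φ hΦ1 hΦ
  obtain ⟨sq, h1, hsq⟩ := exists_openPartialHomeomorph_eqOn_mul_self (𝕜 := ℝ) (V := V) (U := U) hn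
  obtain ⟨s, hs, hs'⟩ := exists_tendsto_mul_self_eq_inv_mul h1 hsq hθ.continuousAt hθθ
  have hk : Tendsto (fun g => g * (s g)⁻¹) (𝓝 1) (𝓝 1) := by
    simpa using tendsto_id.mul hs.inv
  filter_upwards [hk.eventually hfixed, hs'] with g hg ⟨hsg, hθs⟩
  refine ⟨g * (s g)⁻¹, hg ?_, s g, hθs, inv_mul_cancel_right _ _⟩
  rw [map_mul, map_inv, hθs, inv_inv, eq_mul_inv_iff_mul_eq, mul_assoc, hsg, mul_inv_cancel_left]

end Cartan

section Connected

theorem exists_mem_forall_span_image_le (R : Type*) {A α : Type*} [Semiring R] [AddCommMonoid A]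
    [Module R A] [IsArtinian R A] (f : α → A) (l : Filter α) :
    ∃ N ∈ l, ∀ M ∈ l, Submodule.span R (f '' N) ≤ Submodule.span R (f '' M) := by
  obtain ⟨_, ⟨N, hN, rfl⟩, hmin⟩ :=
    IsArtinian.set_has_minimal ((fun N => Submodule.span R (f '' N)) '' {N | N ∈ l})
      ⟨_, univ, univ_mem, rfl⟩
  refine ⟨N, hN, fun M hM => ?_⟩
  have hle : Submodule.span R (f '' (N ∩ M)) ≤ Submodule.span R (f '' N) :=
    Submodule.span_mono (image_mono inter_subset_left)
  rw [← eq_of_le_of_not_lt hle (hmin _ ⟨_, inter_mem hN hM, rfl⟩)]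
  exact Submodule.span_mono (image_mono inter_subset_right)

theorem submonoid_eq_top_of_mem_nhds_one {G : Type*} [Group G] [TopologicalSpace G]
    [IsTopologicalGroup G] [ConnectedSpace G] {S : Submonoid G} (hS : (S : Set G) ∈ 𝓝 1) :
    S = ⊤ := by
  let H : Subgroup G :=
    { carrier := {g | g ∈ S ∧ g⁻¹ ∈ S}
      one_mem' := ⟨S.one_mem, by simp⟩
      mul_mem' := fun ha hb => ⟨S.mul_mem ha.1 hb.1, by simpa using S.mul_mem hb.2 ha.2⟩
      inv_mem' := fun ha => ⟨ha.2, by simpa using ha.1⟩ }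
  have hH : (H : Set G) ∈ 𝓝 1 := inter_mem hS (inv_mem_nhds_one G hS)
  have hopen : IsOpen (H : Set G) := H.isOpen_of_mem_nhds hH
  have huniv : (H : Set G) = univ :=
    IsClopen.eq_univ ⟨H.isClosed_of_isOpen hopen, hopen⟩ ⟨1, H.one_mem⟩
  exact eq_top_iff.2 fun g _ => (huniv ▸ mem_univ g : g ∈ (H : Set G)).1

theorem map_mem_span_image_of_mem_nhds_one {R A G : Type*} [CommRing R] [Ring A] [Algebra R A]
    [IsArtinian R A] [Group G] [TopologicalSpace G] [IsTopologicalGroup G] [ConnectedSpace G]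
    (f : G →* A) {N : Set G} (hN : N ∈ 𝓝 1) (g : G) : f g ∈ Submodule.span R (f '' N) := by
  obtain ⟨M, hM, hmin⟩ := exists_mem_forall_span_image_le R f (𝓝 1)
  let B := Submodule.span R (f '' M)
  have hmul {a b : A} (ha : a ∈ B) (hb : b ∈ B) : a * b ∈ B := by
    obtain ⟨M', hM', hMM'⟩ := exists_nhds_one_split hM
    have hab := Submodule.mul_mem_mul (hmin M' hM' ha) (hmin M' hM' hb)
    rw [Submodule.span_mul_span] at hab
    refine Submodule.span_mono ?_ hab
    rintro _ ⟨_, ⟨x, hx, rfl⟩, _, ⟨y, hy, rfl⟩, rfl⟩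
    exact ⟨x * y, hMM' x hx y hy, map_mul f x y⟩
  have hfM {x : G} (hx : x ∈ M) : f x ∈ B := Submodule.subset_span (mem_image_of_mem f hx)
  let S : Submonoid G :=
    { carrier := {g | f g ∈ B}
      one_mem' := hfM (mem_of_mem_nhds hM)
      mul_mem' := fun ha hb => by simpa using hmul ha hb }
  have hS : S = ⊤ := submonoid_eq_top_of_mem_nhds_one (mem_of_superset hM fun x hx => hfM hx)
  exact hmin N hN (hS ▸ Submonoid.mem_top g : g ∈ S)

end Connected

section LinearAlgebra

theorem finrank_le_one_of_commute_of_span_eq_top {k W ι : Type*} [Field k] [IsAlgClosed k]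
    [AddCommGroup W] [Module k W] [FiniteDimensional k W] {T : ι → Module.End k W}
    (hcomm : ∀ i j, Commute (T i) (T j))
    (hspan : ∀ w ≠ 0, Submodule.span k (range fun i => T i w) = ⊤) : finrank k W ≤ 1 := by
  rcases subsingleton_or_nontrivial W with _ | _
  · exact finrank_zero_of_subsingleton.trans_le zero_le_one
  have hscalar (i : ι) : ∃ c : k, ∀ u, T i u = c • u := by
    obtain ⟨c, hc⟩ := Module.End.exists_eigenvalue (T i)
    obtain ⟨v, hv⟩ := hc.exists_hasEigenvector
    have htop : Module.End.eigenspace (T i) c = ⊤ := by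
      rw [eq_top_iff, ← hspan v hv.2, Submodule.span_le]
      rintro _ ⟨j, rfl⟩
      rw [SetLike.mem_coe, Module.End.mem_eigenspace_iff, ← Module.End.mul_apply, hcomm i j,
        Module.End.mul_apply, hv.apply_eq_smul, map_smul]
    exact ⟨c, fun u => Module.End.mem_eigenspace_iff.1 (htop ▸ Submodule.mem_top)⟩
  obtain ⟨w, hw⟩ := exists_ne (0 : W)
  have hle : (⊤ : Submodule k W) ≤ Submodule.span k {w} := by
    rw [← hspan w hw, Submodule.span_le]
    rintro _ ⟨i, rfl⟩
    obtain ⟨c, hc⟩ := hscalar i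
    exact Submodule.mem_span_singleton.2 ⟨c, (hc w).symm⟩
  exact finrank_le_one w fun u => Submodule.mem_span_singleton.1 (hle Submodule.mem_top)

theorem span_range_apply_eq_top_of_isIrreducible {k G W : Type*} [Field k] [Group G]
    [AddCommGroup W] [Module k W] {ρ : Representation k G W} (hρ : ρ.IsIrreducible) {v : W}
    (hv : v ≠ 0) :
    Submodule.span k (range fun g => ρ g v) = ⊤ := by
  have := hρ
  let S : Subrepresentation ρ :=
    { toSubmodule := Submodule.span k (range fun g => ρ g v)
      apply_mem_toSubmodule := fun g w hw => by
        rw [← Submodule.mem_comap]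
        refine Submodule.span_le.2 ?_ hw
        rintro _ ⟨h, rfl⟩
        exact Submodule.subset_span ⟨g * h, by simp⟩ }
  have hvS : v ∈ S.toSubmodule := Submodule.subset_span ⟨1, by simp⟩
  have hS : S = ⊤ := (eq_bot_or_eq_top S).resolve_left fun h => hv (by rw [h] at hvS; exact hvS)
  exact congrArg Subrepresentation.toSubmodule hS

end LinearAlgebra

section Averaging

variable {G : Type*} [Group G] {E : Type*} [NormedAddCommGroup E] [InnerProductSpace ℂ E]
  {ρ : Representation ℂ G E}

theorem inner_apply_left_of_inner_map_map
    (hinner : ∀ g v w, inner ℂ (ρ g v) (ρ g w) = inner ℂ v w) (g : G) (v w : E) :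
    inner ℂ (ρ g v) w = inner ℂ v (ρ g⁻¹ w) := by
  rw [← hinner g⁻¹ (ρ g v) w, ρ.inv_self_apply]

variable [CompleteSpace E] [ρ.invariants.HasOrthogonalProjection] [TopologicalSpace G]
  [CompactSpace G] [MeasurableSpace G] [BorelSpace G] {μ : Measure G}
  [IsProbabilityMeasure μ] [μ.IsMulLeftInvariant]

theorem integral_apply_eq_starProjection_invariants [ContinuousMul G]
    (hcont : ∀ v, Continuous fun g => ρ g v)
    (hinner : ∀ g v w, inner ℂ (ρ g v) (ρ g w) = inner ℂ v w) (v : E) :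
    ∫ g, ρ g v ∂μ = ρ.invariants.starProjection v := by
  have hint : Integrable (fun g => ρ g v) μ :=
    (hcont v).integrable_of_hasCompactSupport (.of_compactSpace _)
  refine (Submodule.eq_starProjection_of_mem_of_inner_eq_zero (fun h => ?_) fun w hw => ?_).symm
  · calc ρ h (∫ g, ρ g v ∂μ) = ∫ g, ρ h (ρ g v) ∂μ :=
          (((ρ h).isometryOfInner (hinner h)).toContinuousLinearMap.integral_comp_comm hint).symm
      _ = ∫ g, ρ (h * g) v ∂μ := by simp
      _ = ∫ g, ρ g v ∂μ := integral_mul_left_eq_self (fun g => ρ g v) h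
  · have hconst (g : G) : inner ℂ w (ρ g v) = inner ℂ w v := by
      rw [← hinner g w v, hw g]
    rw [inner_eq_zero_symm, inner_sub_right, ← integral_inner hint, sub_eq_zero]
    simp [hconst]

theorem integral_apply_inv_eq_starProjection_invariants [IsTopologicalGroup G]
    (hcont : ∀ v, Continuous fun g => ρ g v)
    (hinner : ∀ g v w, inner ℂ (ρ g v) (ρ g w) = inner ℂ v w) (v : E) :
    ∫ g, ρ g⁻¹ v ∂μ = ρ.invariants.starProjection v := by
  have hint : Integrable (fun g => ρ g⁻¹ v) μ :=
    ((hcont v).comp continuous_inv).integrable_of_hasCompactSupport (.of_compactSpace _)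
  refine ext_inner_left ℂ fun w => ?_
  have hint' : Integrable (fun g => ρ g w) μ :=
    (hcont w).integrable_of_hasCompactSupport (.of_compactSpace _)
  calc inner ℂ w (∫ g, ρ g⁻¹ v ∂μ) = ∫ g, inner ℂ w (ρ g⁻¹ v) ∂μ := (integral_inner hint w).symm
    _ = ∫ g, inner ℂ (ρ g w) v ∂μ := by
      simp only [inner_apply_left_of_inner_map_map hinner]
    _ = inner ℂ (∫ g, ρ g w ∂μ) v := by
      simp only [← inner_conj_symm _ v, integral_conj, integral_inner hint']
    _ = inner ℂ w (ρ.invariants.starProjection v) := by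
      rw [integral_apply_eq_starProjection_invariants hcont hinner,
        Submodule.inner_starProjection_left_eq_right]

end Averaging

namespace UnitaryIrrep

section Subgroup

variable {U : Type*} [Group U] [TopologicalSpace U] (π : UnitaryIrrep U) {K : Subgroup U}

theorem mem_fixedVectors {v : π.E} : v ∈ π.fixedVectors K ↔ ∀ k ∈ K, π.ρ k v = v :=
  ⟨fun h k hk => h ⟨k, hk⟩, fun h k => h k k.2⟩

theorem inner_apply_left (g : U) (v w : π.E) :
    inner ℂ (π.ρ g v) w = inner ℂ v (π.ρ g⁻¹ w) :=
  inner_apply_left_of_inner_map_map π.inner_map_map g v w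

variable [CompactSpace U] [IsTopologicalGroup U] [MeasurableSpace K] [BorelSpace K]
  (mK : Measure K) [IsProbabilityMeasure mK] [mK.IsMulLeftInvariant]

theorem integral_apply_subgroup (hK : IsClosed (K : Set U)) (v : π.E) :
    ∫ k : K, π.ρ k v ∂mK = (π.fixedVectors K).starProjection v := by
  have : CompactSpace K := isCompact_iff_compactSpace.1 hK.isCompact
  have : CompleteSpace π.E := FiniteDimensional.complete ℂ π.E
  exact integral_apply_eq_starProjection_invariants (ρ := π.ρ.comp K.subtype)
    (fun v => (π.continuous_apply v).comp continuous_subtype_val)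
    (fun k => π.inner_map_map k) v

theorem integral_apply_inv_subgroup (hK : IsClosed (K : Set U)) (v : π.E) :
    ∫ k : K, π.ρ (k : U)⁻¹ v ∂mK = (π.fixedVectors K).starProjection v := by
  have : CompactSpace K := isCompact_iff_compactSpace.1 hK.isCompact
  have : CompleteSpace π.E := FiniteDimensional.complete ℂ π.E
  exact integral_apply_inv_eq_starProjection_invariants (ρ := π.ρ.comp K.subtype)
    (fun v => (π.continuous_apply v).comp continuous_subtype_val)
    (fun k => π.inner_map_map k) v

end Subgroup
section Compression

variable {U : Type*} [Group U] [TopologicalSpace U] (π : UnitaryIrrep U) (K : Subgroup U)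

/-- The compression `P π(g) P` of `π(g)` to the space of `K`-fixed vectors, `P` being the
orthogonal projection onto that space. -/
noncomputable def compression (g : U) : Module.End ℂ (π.fixedVectors K) :=
  (π.fixedVectors K).orthogonalProjectionOnto.toLinearMap ∘ₗ π.ρ g ∘ₗ (π.fixedVectors K).subtype

theorem coe_compression_apply (g : U) (v : π.fixedVectors K) :
    (π.compression K g v : π.E) = (π.fixedVectors K).starProjection (π.ρ g v) := rfl

theorem inner_compression_apply (g : U) (w v : π.fixedVectors K) :
    inner ℂ w (π.compression K g v) = inner ℂ (w : π.E) (π.ρ g v) :=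
  Submodule.inner_orthogonalProjectionOnto_eq_of_mem_left w (π.ρ g v)

theorem span_range_compression_apply_eq_top {v : π.fixedVectors K} (hv : v ≠ 0) :
    Submodule.span ℂ (range fun g => π.compression K g v) = ⊤ := by
  have hspan := span_range_apply_eq_top_of_isIrreducible π.irreducible
    (v := (v : π.E)) (by simpa using hv)
  have hsurj : Function.Surjective (π.fixedVectors K).orthogonalProjectionOnto.toLinearMap :=
    fun w => ⟨w, Submodule.orthogonalProjectionOnto_mem_subspace_eq_self w⟩
  rw [← LinearMap.range_eq_top.2 hsurj, LinearMap.range_eq_map, ← hspan, Submodule.map_span,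
    ← range_comp]
  rfl

variable {K}

section Averaging

variable [CompactSpace U] [IsTopologicalGroup U] [MeasurableSpace K] [BorelSpace K]
  (mK : Measure K) [IsProbabilityMeasure mK] [mK.IsMulLeftInvariant]

theorem inner_compression_compression_apply (hK : IsClosed (K : Set U)) (g h : U)
    (w v : π.fixedVectors K) :
    inner ℂ w (π.compression K g (π.compression K h v)) =
      ∫ k : K, inner ℂ (w : π.E) (π.ρ (g * k * h) v) ∂mK := by
  have : CompactSpace K := isCompact_iff_compactSpace.1 hK.isCompact
  have : CompleteSpace π.E := FiniteDimensional.complete ℂ π.E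
  have hint : Integrable (fun k : K => π.ρ k (π.ρ h v)) mK :=
    ((π.continuous_apply _).comp continuous_subtype_val).integrable_of_hasCompactSupport
      (.of_compactSpace _)
  rw [inner_compression_apply, coe_compression_apply, ← π.integral_apply_subgroup mK hK,
    ← inv_inv g, ← π.inner_apply_left, ← integral_inner hint]
  simp [π.inner_apply_left]

theorem inner_compression_compression_apply_inv (hK : IsClosed (K : Set U)) (g h : U)
    (w v : π.fixedVectors K) :
    inner ℂ w (π.compression K g (π.compression K h v)) =
      ∫ k : K, inner ℂ (w : π.E) (π.ρ (g * (k : U)⁻¹ * h) v) ∂mK := by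
  have : CompactSpace K := isCompact_iff_compactSpace.1 hK.isCompact
  have : CompleteSpace π.E := FiniteDimensional.complete ℂ π.E
  have hint : Integrable (fun k : K => π.ρ (k : U)⁻¹ (π.ρ h v)) mK :=
    ((π.continuous_apply _).comp
      continuous_subtype_val.inv).integrable_of_hasCompactSupport (.of_compactSpace _)
  rw [inner_compression_apply, coe_compression_apply, ← π.integral_apply_inv_subgroup mK hK,
    ← inv_inv g, ← π.inner_apply_left, ← integral_inner hint]
  simp [π.inner_apply_left]

end Averaging

end Compression

section SymmetricPair

variable {V : Type*} [NormedAddCommGroup V] [NormedSpace ℝ V] [CompleteSpace V]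
  {U : Type*} [Group U] [TopologicalSpace U] [ChartedSpace V U] [LieGroup 𝓘(ℝ, V) ∞ U]
  {θ : U →* U} {K : Subgroup U} (π : UnitaryIrrep U)

theorem eventually_inner_apply_involution_inv (hK : IsSymmetricPair (V := V) θ K)
    (w v : π.fixedVectors K) :
    ∀ᶠ g in 𝓝 (1 : U), inner ℂ (w : π.E) (π.ρ (θ g)⁻¹ v) = inner ℂ (w : π.E) (π.ρ g v) := by
  filter_upwards [eventually_exists_mul_eq_of_involutive (by simp) (hK.contMDiff 1) hK.involutive]
  rintro _ ⟨k, hk, s, hs, rfl⟩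
  have hkK : k ∈ K := hK.identityComponent_subset hk
  have hθk : θ k = k := hK.subset_fixedPoints hkK
  have hfix (u : π.fixedVectors K) : π.ρ k⁻¹ u = u :=
    π.mem_fixedVectors.1 u.2 _ (K.inv_mem hkK)
  calc inner ℂ (w : π.E) (π.ρ (θ (k * s))⁻¹ v)
      = inner ℂ (w : π.E) (π.ρ s (π.ρ k⁻¹ v)) := by simp [hθk, hs]
    _ = inner ℂ (π.ρ k⁻¹ w) (π.ρ s v) := by rw [hfix, hfix]
    _ = inner ℂ (w : π.E) (π.ρ (k * s) v) := by simp [π.inner_apply_left]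

variable [ConnectedSpace U]

theorem inner_apply_involution_inv (hK : IsSymmetricPair (V := V) θ K)
    (w v : π.fixedVectors K) (g : U) :
    inner ℂ (w : π.E) (π.ρ (θ g)⁻¹ v) = inner ℂ (w : π.E) (π.ρ g v) := by
  have : IsTopologicalGroup U := topologicalGroup_of_lieGroup 𝓘(ℝ, V) ∞
  -- `g ↦ π(θ(g)⁻¹)` is an antihomomorphism, whence the opposite algebra
  let f : U →* Module.End ℂ π.E × (Module.End ℂ π.E)ᵐᵒᵖ :=
    { toFun := fun x => (π.ρ x, MulOpposite.op (π.ρ (θ x)⁻¹))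
      map_one' := by simp
      map_mul' := by simp }
  let ℓ : Module.End ℂ π.E × (Module.End ℂ π.E)ᵐᵒᵖ →ₗ[ℂ] ℂ :=
    { toFun := fun T => inner ℂ (w : π.E) (T.2.unop v) - inner ℂ (w : π.E) (T.1 v)
      map_add' := fun S T => by simp [add_sub_add_comm]
      map_smul' := fun c T => by simp [mul_sub] }
  have hker : Submodule.span ℂ (f '' {x | ℓ (f x) = 0}) ≤ LinearMap.ker ℓ :=
    Submodule.span_le.2 (image_subset_iff.2 fun _ hx => hx)
  have hnhds : {x | ℓ (f x) = 0} ∈ 𝓝 (1 : U) := by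
    filter_upwards [π.eventually_inner_apply_involution_inv hK w v] with x hx
    exact sub_eq_zero.2 hx
  exact sub_eq_zero.1 (hker (map_mem_span_image_of_mem_nhds_one f hnhds g))

theorem compression_involution_inv (hK : IsSymmetricPair (V := V) θ K) (g : U) :
    π.compression K (θ g)⁻¹ = π.compression K g :=
  LinearMap.ext fun v => ext_inner_left ℂ fun w => by
    rw [inner_compression_apply, inner_compression_apply, π.inner_apply_involution_inv hK]

theorem commute_compression [CompactSpace U] (hK : IsSymmetricPair (V := V) θ K) (g h : U) :
    Commute (π.compression K g) (π.compression K h) := by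
  have : IsTopologicalGroup U := topologicalGroup_of_lieGroup 𝓘(ℝ, V) ∞
  have : CompactSpace K := isCompact_iff_compactSpace.1 hK.isClosed.isCompact
  let : MeasurableSpace K := borel K
  have : BorelSpace K := ⟨rfl⟩
  let mK : Measure K := Measure.haarMeasure ⊤
  have : IsProbabilityMeasure mK := ⟨Measure.haarMeasure_self⟩
  refine LinearMap.ext fun v => ext_inner_left ℂ fun w => ?_
  have hθ (k : K) : (θ (g * k * h))⁻¹ = (θ h)⁻¹ * (k : U)⁻¹ * (θ g)⁻¹ := by
    have hθk : θ k = k := hK.subset_fixedPoints k.2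
    simp only [map_mul, hθk, mul_inv_rev, mul_assoc]
  calc inner ℂ w (π.compression K g (π.compression K h v))
      = ∫ k : K, inner ℂ (w : π.E) (π.ρ (g * k * h) v) ∂mK :=
        π.inner_compression_compression_apply mK hK.isClosed g h w v
    _ = ∫ k : K, inner ℂ (w : π.E) (π.ρ ((θ h)⁻¹ * (k : U)⁻¹ * (θ g)⁻¹) v) ∂mK := by
        simp only [← hθ, π.inner_apply_involution_inv hK]
    _ = inner ℂ w (π.compression K (θ h)⁻¹ (π.compression K (θ g)⁻¹ v)) :=
        (π.inner_compression_compression_apply_inv mK hK.isClosed _ _ w v).symm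
    _ = inner ℂ w (π.compression K h (π.compression K g v)) := by
        rw [π.compression_involution_inv hK, π.compression_involution_inv hK]

end SymmetricPair

end UnitaryIrrep

/-- `(U, K)` is a Gelfand pair: every irreducible unitary representation of `U` has, up to scalars,
at most one nonzero `K`-fixed vector.  For compact `U` and closed `K` this is equivalent to the
commutativity of the convolution algebra of bi-`K`-invariant functions. -/
def IsGelfandPair {U : Type*} [Group U] [TopologicalSpace U] (K : Subgroup U) : Prop :=
  ∀ π : UnitaryIrrep U, finrank ℂ (π.fixedVectors K) ≤ 1

theorem IsSymmetricPair.isGelfandPair {V : Type*} [NormedAddCommGroup V] [NormedSpace ℝ V]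
    [CompleteSpace V] {U : Type*} [Group U] [TopologicalSpace U] [ChartedSpace V U]
    [LieGroup 𝓘(ℝ, V) ∞ U] [CompactSpace U] [ConnectedSpace U] {θ : U →* U} {K : Subgroup U}
    (hK : IsSymmetricPair (V := V) θ K) : IsGelfandPair K :=
  fun π => finrank_le_one_of_commute_of_span_eq_top (π.commute_compression hK)
    fun _ hw => π.span_range_compression_apply_eq_top K hw

namespace UnitaryIrrep

section HilbertSchmidt

variable {U : Type*} [Group U] [TopologicalSpace U] (π : UnitaryIrrep U)

theorem hsNormSq_smul (c : ℂ) (T : π.E →ₗ[ℂ] π.E) :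
    π.hsNormSq (c • T) = ‖c‖ ^ 2 * π.hsNormSq T := by
  simp only [hsNormSq, LinearMap.smul_apply, norm_smul, mul_pow, Finset.mul_sum]

theorem hsNormSq_innerₛₗ_smulRight (X Y : π.E) :
    π.hsNormSq ((innerₛₗ ℂ X).smulRight Y) = ‖X‖ ^ 2 * ‖Y‖ ^ 2 := by
  simp [hsNormSq, norm_smul, mul_pow, ← Finset.sum_mul, OrthonormalBasis.sum_sq_norm_inner_left]

end HilbertSchmidt

section Fourier

variable {U : Type*} [Group U] [TopologicalSpace U] [IsTopologicalGroup U] [CompactSpace U]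
  [MeasurableSpace U] [BorelSpace U] (π : UnitaryIrrep U) {K : Subgroup U}

theorem fourier_apply (μ : Measure U) [IsFiniteMeasure μ] (v : π.E) :
    π.fourier μ v = ∫ g, π.ρ g⁻¹ v ∂μ := rfl

theorem fourier_dirac_one : π.fourier (Measure.dirac 1) = 1 := by
  have : ProperSpace π.E := FiniteDimensional.proper ℂ π.E
  ext v
  have hcont : Continuous fun g : U => π.ρ g⁻¹ v := (π.continuous_apply v).comp continuous_inv
  rw [fourier_apply, integral_dirac' _ _ hcont.stronglyMeasurable]
  simp

variable [MeasurableMul₂ U]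

theorem fourier_mconv (μ ν : Measure U) [IsFiniteMeasure μ] [IsFiniteMeasure ν]
    [IsFiniteMeasure (Measure.mconv μ ν)] :
    π.fourier (Measure.mconv μ ν) = π.fourier ν * π.fourier μ := by
  have : CompleteSpace π.E := FiniteDimensional.complete ℂ π.E
  ext v
  calc π.fourier (Measure.mconv μ ν) v = ∫ x, ∫ y, π.ρ (x * y)⁻¹ v ∂ν ∂μ :=
        integral_mconv (π.integrable_apply_inv (Measure.mconv μ ν) v)
    _ = ∫ x, π.fourier ν (π.ρ x⁻¹ v) ∂μ := by simp [fourier_apply]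
    _ = π.fourier ν (π.fourier μ v) :=
        (π.fourier ν).toContinuousLinearMap.integral_comp_comm (π.integrable_apply_inv μ v)

theorem fourier_convPow (μ : Measure U) [IsFiniteMeasure μ] (p : ℕ) :
    π.fourier (convPow μ p) = π.fourier μ ^ p := by
  induction p with
  | zero => exact π.fourier_dirac_one
  | succ p ih =>
    have : IsFiniteMeasure (Measure.mconv (convPow μ p) μ) :=
      inferInstanceAs (IsFiniteMeasure (convPow μ (p + 1)))
    rw [pow_succ', ← ih]
    exact π.fourier_mconv (convPow μ p) μ

variable (mK : Measure K) [IsProbabilityMeasure mK] [mK.IsMulLeftInvariant]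

theorem fourier_orbitalMeasure (hK : IsClosed (K : Set U)) (a : U) :
    π.fourier (orbitalMeasure mK a) =
      (π.fixedVectors K).starProjection.toLinearMap * π.ρ a⁻¹ *
        (π.fixedVectors K).starProjection.toLinearMap := by
  have : CompactSpace K := isCompact_iff_compactSpace.1 hK.isCompact
  have : ProperSpace π.E := FiniteDimensional.proper ℂ π.E
  have : CompleteSpace π.E := FiniteDimensional.complete ℂ π.E
  have : BorelSpace K := Subtype.borelSpace _
  set P := (π.fixedVectors K).starProjection
  ext v
  have hcont : Continuous fun g : U => π.ρ g⁻¹ v := (π.continuous_apply v).comp continuous_inv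
  have hmeas : Measurable fun k : K × K => (k.1 : U) * a * (k.2 : U) := by fun_prop
  have hint : Integrable (fun k : K × K => π.ρ ((k.1 : U) * a * (k.2 : U))⁻¹ v) (mK.prod mK) :=
    (integrable_map_measure hcont.aestronglyMeasurable hmeas.aemeasurable).1
      (π.integrable_apply_inv (orbitalMeasure mK a) v)
  have hintK : Integrable (fun k : K => π.ρ (k : U)⁻¹ v) mK :=
    (hcont.comp continuous_subtype_val).integrable_of_hasCompactSupport (.of_compactSpace _)
  calc π.fourier (orbitalMeasure mK a) v
      = ∫ k₁ : K, ∫ k₂ : K, π.ρ ((k₁ : U) * a * (k₂ : U))⁻¹ v ∂mK ∂mK := by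
        rw [fourier_apply, orbitalMeasure,
          integral_map hmeas.aemeasurable hcont.aestronglyMeasurable, integral_prod _ hint]
    _ = ∫ k₁ : K, P (π.ρ a⁻¹ (π.ρ (k₁ : U)⁻¹ v)) ∂mK := by
        simp only [mul_inv_rev, map_mul, Module.End.mul_apply, π.integral_apply_inv_subgroup mK hK]
        rfl
    _ = P (π.ρ a⁻¹ (P v)) := by
        rw [← π.integral_apply_inv_subgroup mK hK v]
        exact (P ∘L (π.ρ a⁻¹).toContinuousLinearMap).integral_comp_comm hintK

theorem hsNormSq_fourier_convPow_orbitalMeasure_eq_zero (hK : IsClosed (K : Set U))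
    (hπ : π.fixedVectors K = ⊥) (a : U) {p : ℕ} (hp : p ≠ 0) :
    π.hsNormSq (π.fourier (convPow (orbitalMeasure mK a) p)) = 0 := by
  have hzero : π.fourier (orbitalMeasure mK a) = 0 := by
    rw [π.fourier_orbitalMeasure mK hK, hπ, Submodule.starProjection_bot]
    exact mul_zero _
  rw [fourier_convPow, hzero, zero_pow hp]
  simp [hsNormSq]

end Fourier

section Spherical

variable {U : Type*} [Group U] [TopologicalSpace U] {π : UnitaryIrrep U} {K : Subgroup U} {X : π.E}

theorem starProjection_fixedVectors_eq_smulRight (hπ : π.IsSpherical K)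
    (hX : X ∈ π.fixedVectors K) (hX1 : ‖X‖ = 1) :
    (π.fixedVectors K).starProjection.toLinearMap = (innerₛₗ ℂ X).smulRight X := by
  have hspan : Submodule.span ℂ {X} = π.fixedVectors K := by
    refine Submodule.eq_of_le_of_finrank_eq ((Submodule.span_singleton_le_iff_mem _ _).2 hX) ?_
    rw [hπ, finrank_span_singleton (norm_ne_zero_iff.1 (by simp [hX1]))]
  ext v
  simp only [← hspan]
  exact Submodule.starProjection_unit_singleton ℂ hX1 v

variable [IsTopologicalGroup U] [CompactSpace U] [MeasurableSpace U] [BorelSpace U]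
  [MeasurableMul₂ U] (mK : Measure K) [IsProbabilityMeasure mK] [mK.IsMulLeftInvariant]

theorem fourier_convPow_orbitalMeasure_eq_smul (hK : IsClosed (K : Set U)) (hπ : π.IsSpherical K)
    (hX : X ∈ π.fixedVectors K) (hX1 : ‖X‖ = 1) (a : U) {p : ℕ} (hp : p ≠ 0) :
    π.fourier (convPow (orbitalMeasure mK a) p) =
      inner ℂ X (π.ρ a⁻¹ X) ^ p • (innerₛₗ ℂ X).smulRight X := by
  have hidem : IsIdempotentElem ((innerₛₗ ℂ X).smulRight X : Module.End ℂ π.E) :=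
    LinearMap.ext fun v => by simp [hX1]
  have hone : π.fourier (orbitalMeasure mK a) =
      inner ℂ X (π.ρ a⁻¹ X) • (innerₛₗ ℂ X).smulRight X := by
    rw [π.fourier_orbitalMeasure mK hK, starProjection_fixedVectors_eq_smulRight hπ hX hX1]
    ext v
    simp [smul_smul, mul_comm]
  rw [fourier_convPow, hone, smul_pow, hidem.pow_eq hp]

theorem hsNormSq_fourier_convPow_orbitalMeasure (hK : IsClosed (K : Set U))
    (hπ : π.IsSpherical K) (hX : X ∈ π.fixedVectors K) (hX1 : ‖X‖ = 1) (a : U) {p : ℕ}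
    (hp : p ≠ 0) :
    π.hsNormSq (π.fourier (convPow (orbitalMeasure mK a) p)) =
      ‖inner ℂ X (π.ρ a X)‖ ^ (2 * p) := by
  rw [fourier_convPow_orbitalMeasure_eq_smul mK hK hπ hX hX1 a hp, hsNormSq_smul,
    hsNormSq_innerₛₗ_smulRight, hX1, norm_pow, ← π.inner_apply_left, norm_inner_symm]
  ring

end Spherical

end UnitaryIrrep

theorem proposition2_general {U : Type*} [Group U] [TopologicalSpace U] [IsTopologicalGroup U]
    [CompactSpace U] [MeasurableSpace U] [BorelSpace U] [MeasurableMul₂ U] {K : Subgroup U}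
    (hKc : IsClosed (K : Set U)) (hK : IsGelfandPair K) (mK : Measure K)
    [IsProbabilityMeasure mK] [mK.IsMulLeftInvariant] (r : UnitaryDual U → UnitaryIrrep U)
    (_hr : ∀ c, Quotient.mk _ (r c) = c) (X : ∀ c : UnitaryDual U, (r c).E)
    (hX : ∀ c, (r c).IsSpherical K → X c ∈ (r c).fixedVectors K ∧ ‖X c‖ = 1)
    (a : U) {p : ℕ} (hp : p ≠ 0) :
    plancherelNormSq r (convPow (orbitalMeasure mK a) p) =
      ∑' c : {c : UnitaryDual U // (r c).IsSpherical K},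
        (finrank ℂ (r c).E : ℝ≥0∞) *
          ENNReal.ofReal (‖inner ℂ (X c) ((r c).ρ a (X c))‖ ^ (2 * p)) := by
  classical
  refine Eq.trans (tsum_congr fun c => ?_) (tsum_subtype {c | (r c).IsSpherical K} fun c =>
    (finrank ℂ (r c).E : ℝ≥0∞) *
      ENNReal.ofReal (‖inner ℂ (X c) ((r c).ρ a (X c))‖ ^ (2 * p))).symm
  by_cases hc : (r c).IsSpherical K
  · rw [indicator_of_mem (by exact hc), UnitaryIrrep.hsNormSq_fourier_convPow_orbitalMeasure mK hKc
      hc (hX c hc).1 (hX c hc).2 a hp]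
  · have hbot : (r c).fixedVectors K = ⊥ :=
      Submodule.finrank_eq_zero.1 (Nat.lt_one_iff.1 ((hK (r c)).lt_of_ne hc))
    rw [indicator_of_notMem (by exact hc),
      (r c).hsNormSq_fourier_convPow_orbitalMeasure_eq_zero mK hKc hbot a hp]
    simp

theorem proposition2
    {V : Type*} [NormedAddCommGroup V] [NormedSpace ℝ V] [FiniteDimensional ℝ V]
    {U : Type*} [Group U] [TopologicalSpace U] [T2Space U] [ChartedSpace V U]
    [LieGroup 𝓘(ℝ, V) ∞ U] [IsTopologicalGroup U] [CompactSpace U] [ConnectedSpace U]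
    [MeasurableSpace U] [BorelSpace U]
    (θ : U →* U) (K : Subgroup U) (hK : IsSymmetricPair (V := V) θ K)
    (mK : Measure K) [mK.IsHaarMeasure] [IsProbabilityMeasure mK]
    (r : UnitaryDual U → UnitaryIrrep U) (hr : ∀ c, Quotient.mk _ (r c) = c)
    (X : ∀ c : UnitaryDual U, (r c).E)
    (hX : ∀ c, (r c).IsSpherical K → X c ∈ (r c).fixedVectors K ∧ ‖X c‖ = 1)
    (a : U) (p : ℕ) (hp : 2 ≤ p) :
    plancherelNormSq r (convPow (orbitalMeasure mK a) p) =
      ∑' c : {c : UnitaryDual U // (r c).IsSpherical K},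
        (finrank ℂ (r c).E : ℝ≥0∞) *
          ENNReal.ofReal (‖inner ℂ (X c) ((r c).ρ a (X c))‖ ^ (2 * p)) := by
  have : CompleteSpace V := FiniteDimensional.complete ℝ V
  have : ProperSpace V := FiniteDimensional.proper ℝ V
  have : SecondCountableTopology U := ChartedSpace.secondCountable_of_sigmaCompact V U
  exact proposition2_general hK.isClosed hK.isGelfandPair mK r hr X hX a (by lia)
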